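/- Consider a storage device with charging efficiency $\alpha_c\in(0,1)$, discharging efficiency $\alpha_d\in(0,1)$, round-trip efficiency $\alpha=\alpha_c\alpha_d$ and power storage capacity $S_{\max}\ge 0$ (with no further limits on charging and discharging power), and a fast-ramping generator of capacity $G_{\max}\ge 0$. Let the prediction errors $\Delta_1,\Delta_2,\dots$ be IID Laplace$(\lambda)$ with $\lambda>0$, i.e. with density $\frac{\lambda}{2}e^{-\lambda|\delta|}$, and let the initial stored power $S_1\in[0,S_{\max}]$ be independent of them. The system is operated by the greedy (optimal) policy, whose generation $G_i$, charging power $C_i$ and discharging power $D_i$ are $$(G_i,C_i,D_i)=\begin{cases} \left(0,\ \frac{S_{\max}-S_i}{\alpha_c},\ 0\right) & \text{if } \frac{S_{\max}-S_i}{\alpha_c}\le\Delta_i,\\ (0,\ \Delta_i,\ 0) & \text{if } 0\le\Delta_i<\frac{S_{\max}-S_i}{\alpha_c},\\ (0,\ 0,\ -\Delta_i) & \text{if } -\alpha_d S_i\le\Delta_i<0,\\ (-\Delta_i-\alpha_d S_i,\ 0,\ \alpha_d S_i) & \text{if } -G_{\max}-\alpha_d S_i\le\Delta_i<-\alpha_d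 S_i,\\ (G_{\max},\ 0,\ \alpha_d S_i) & \text{if } \Delta_i<-G_{\max}-\alpha_d S_i, \end{cases}$$ and the stored power evolves by $S_{i+1}=S_i+\alpha_c C_i-D_i/\alpha_d$. Write $\kappa=e^{-(1/\alpha_c-\alpha_d)\lambda S_{\max}/2}$. Then the Markov chain $(S_i)$ on $[0,S_{\max}]$ has exactly one stationary probability distribution. Its cdf is $$F_S(s)=\frac{1-\frac{1+\alpha}{2}\,e^{-(1/\alpha_c-\alpha_d)\lambda s/2}}{1-\alpha\kappa}\qquad (0\le s<S_{\max}),$$ with $F_S(s)=0$ for $s<0$ and $F_S(s)=1$ for $s\ge S_{\max}$; in particular, if $S_{\max}>0$, it has the atoms $\frac{1-\alpha}{2(1-\alpha\kappa)}$ at $0$ and $\frac{(1-\alpha)\kappa}{2(1-\alpha\kappa)}$ at $S_{\max}$. The sequence $(S_i)$ is identically distributed if and only if $S_1$ has this distribution, and in that case every $G_i$ has the cdf $$F_G(g)=1-\frac{1-\alpha}{2(1-\alpha\kappa)}\,e^{-\lambda g}\qquad(0\le g<G_{\max}),$$ with $F_G(g)=0$ for $g<0$ and $F_G(g)=1$ for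 $g\ge G_{\max}$. -/

import Mathlib

open MeasureTheory ProbabilityTheory

/-- The parameters of a single-bus power system with storage whose charging and discharging
rates are unconstrained: charging efficiency `ac`, discharging efficiency `ad`, power storage
capacity `Smax` and fast-ramping generation capacity `Gmax`. -/
structure StorageSystem where
  /-- charging efficiency -/
  ac : ℝ
  /-- discharging efficiency -/
  ad : ℝ
  /-- power storage capacity -/
  Smax : ℝ
  /-- fast-ramping generation capacity -/
  Gmax : ℝ
  ac_pos : 0 < ac
  ac_lt_one : ac < 1
  ad_pos : 0 < ad
  ad_lt_one : ad < 1
  Smax_nonneg : 0 ≤ Smax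
  Gmax_nonneg : 0 ≤ Gmax

/-- A control action: fast-ramping generation, charging power and discharging power. -/
@[ext]
structure ControlAction where
  /-- fast-ramping generation power `G` -/
  gen : ℝ
  /-- charging power `C` -/
  charge : ℝ
  /-- discharging power `D` -/
  discharge : ℝ

namespace StorageSystem

/-- The round-trip efficiency. -/
def eff (sys : StorageSystem) : ℝ := sys.ac * sys.ad

/-- The set of admissible levels of the stored power. -/
abbrev Level (sys : StorageSystem) : Type := Set.Icc (0 : ℝ) sys.Smax

open Classical in
/-- The greedy policy that minimizes the average fast-ramping generation: the action taken when
the stored power is `s` and the net renewable generation (prediction error) is `d`. -/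
noncomputable def policy (sys : StorageSystem) (s d : ℝ) : ControlAction :=
  if (sys.Smax - s) / sys.ac ≤ d then ⟨0, (sys.Smax - s) / sys.ac, 0⟩
  else if 0 ≤ d then ⟨0, d, 0⟩
  else if -sys.ad * s ≤ d then ⟨0, 0, -d⟩
  else if -sys.Gmax - sys.ad * s ≤ d then ⟨-d - sys.ad * s, 0, sys.ad * s⟩
  else ⟨sys.Gmax, 0, sys.ad * s⟩

/-- The stored power in the next time slot under the greedy policy. -/
noncomputable def next (sys : StorageSystem) (s d : ℝ) : ℝ :=
  s + sys.ac * (sys.policy s d).charge - (sys.policy s d).discharge / sys.ad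

theorem next_mem (sys : StorageSystem) (s : sys.Level) (d : ℝ) :
    sys.next s d ∈ Set.Icc (0 : ℝ) sys.Smax := by
  obtain ⟨s, h0, h1⟩ := s
  have hc := sys.ac_pos
  have hd := sys.ad_pos
  have hM := sys.Smax_nonneg
  simp only [next, policy]
  split_ifs with h2 h3 h4 h5
  · have : sys.ac * ((sys.Smax - s) / sys.ac) = sys.Smax - s := by field_simp
    constructor <;> simp [this] <;> linarith
  · have h6 : d * sys.ac < sys.Smax - s := (lt_div_iff₀ hc).1 (not_le.1 h2)
    have h7 : 0 ≤ sys.ac * d := by positivity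
    constructor <;> simp <;> nlinarith
  · have h6 : -d / sys.ad ≤ s := (div_le_iff₀ hd).2 (by nlinarith)
    have h7 : 0 ≤ -d / sys.ad := div_nonneg (by linarith) hd.le
    constructor <;> simp only [mul_zero, add_zero] <;> linarith
  · have : sys.ad * s / sys.ad = s := by field_simp
    constructor <;> simp [this, hM]
  · have : sys.ad * s / sys.ad = s := by field_simp
    constructor <;> simp [this, hM]

/-- `next` as a map into the set of admissible levels. -/
noncomputable def step (sys : StorageSystem) (s : sys.Level) (d : ℝ) : sys.Level :=
  ⟨sys.next s d, sys.next_mem s d⟩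

/-- The fast-ramping generation under the greedy policy. -/
noncomputable def generation (sys : StorageSystem) (s : sys.Level) (d : ℝ) : ℝ :=
  (sys.policy s d).gen

theorem measurable_step (sys : StorageSystem) :
    Measurable fun p : sys.Level × ℝ => sys.step p.1 p.2 := by
  refine Measurable.subtype_mk ?_
  simp only [next, policy, apply_ite ControlAction.charge, apply_ite ControlAction.discharge]
  have hs : Measurable fun p : sys.Level × ℝ => (p.1 : ℝ) := by fun_prop
  have hd : Measurable fun p : sys.Level × ℝ => p.2 := measurable_snd
  have m1 : MeasurableSet {p : sys.Level × ℝ | (sys.Smax - (p.1 : ℝ)) / sys.ac ≤ p.2} :=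
    measurableSet_le (by fun_prop) hd
  have m2 : MeasurableSet {p : sys.Level × ℝ | 0 ≤ p.2} := measurableSet_le (by fun_prop) hd
  have m3 : MeasurableSet {p : sys.Level × ℝ | -sys.ad * (p.1 : ℝ) ≤ p.2} :=
    measurableSet_le (by fun_prop) hd
  have m4 : MeasurableSet {p : sys.Level × ℝ | -sys.Gmax - sys.ad * (p.1 : ℝ) ≤ p.2} :=
    measurableSet_le (by fun_prop) hd
  refine Measurable.sub (hs.add (Measurable.const_mul ?_ _)) (Measurable.div_const ?_ _)
  · exact .ite m1 (by fun_prop) (.ite m2 hd (.ite m3 (by fun_prop) (.ite m4 (by fun_prop)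
      (by fun_prop))))
  · exact .ite m1 (by fun_prop) (.ite m2 (by fun_prop) (.ite m3 (by fun_prop)
      (.ite m4 (by fun_prop) (by fun_prop))))

end StorageSystem

/-- The Laplace distribution with rate `lam`, with density `(lam / 2) * exp (-lam * |x|)`. -/
noncomputable def laplaceMeasure (lam : ℝ) : Measure ℝ :=
  volume.withDensity fun x => ENNReal.ofReal (lam / 2 * Real.exp (-lam * |x|))

namespace StorageSystem

/-- The transition kernel of the stored power under the greedy policy and independent
Laplace prediction errors: from `s` the chain moves to `step s d` with `d` Laplace distributed. -/
noncomputable def kernel (sys : StorageSystem) (lam : ℝ) : Kernel sys.Level sys.Level where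
  toFun s := (laplaceMeasure lam).map (sys.step s)
  measurable' := by
    have : SFinite (laplaceMeasure lam) := by unfold laplaceMeasure; infer_instance
    refine Measure.measurable_of_measurable_coe _ fun t ht => ?_
    have h : ∀ s : sys.Level, (laplaceMeasure lam).map (sys.step s) t
        = laplaceMeasure lam (Prod.mk s ⁻¹' ((fun p : sys.Level × ℝ => sys.step p.1 p.2) ⁻¹' t)) :=
      fun s => Measure.map_apply (sys.measurable_step.comp measurable_prodMk_left) ht
    simp only [h]
    exact measurable_measure_prodMk_left (sys.measurable_step ht)

/-- The law of the fast-ramping generation when the stored power has law `π` and the prediction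
error is independent of it and Laplace distributed. -/
noncomputable def generationLaw (sys : StorageSystem) (lam : ℝ) (π : Measure sys.Level) :
    Measure ℝ :=
  (π.prod (laplaceMeasure lam)).map fun p => sys.generation p.1 p.2

/-- `S` is the stored power sequence under the greedy policy, driven by the IID Laplace
prediction errors `Δ`, with an initial value that is independent of them. -/
structure IsStoredPower (sys : StorageSystem) (lam : ℝ) {Ω : Type*} [MeasurableSpace Ω]
    (P : Measure Ω) (Δ : ℕ → Ω → ℝ) (S : ℕ → Ω → sys.Level) : Prop where
  measurable_error : ∀ i, Measurable (Δ i)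
  iIndep_error : iIndepFun Δ P
  law_error : ∀ i, P.map (Δ i) = laplaceMeasure lam
  measurable_init : Measurable (S 0)
  indep_init : IndepFun (S 0) (fun ω i => Δ i ω) P
  succ : ∀ i ω, S (i + 1) ω = sys.step (S i ω) (Δ i ω)

open Classical in
/-- The closed form of the cdf of the stationary stored power. -/
noncomputable def storedCDF (sys : StorageSystem) (lam s : ℝ) : ℝ :=
  if s < 0 then 0
  else if s < sys.Smax then
    (1 - (1 + sys.eff) / 2 * Real.exp (-(1 / sys.ac - sys.ad) * lam * s / 2)) /
      (1 - sys.eff * Real.exp (-(1 / sys.ac - sys.ad) * lam * sys.Smax / 2))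
  else 1

open Classical in
/-- The closed form of the cdf of the stationary fast-ramping generation. -/
noncomputable def generationCDF (sys : StorageSystem) (lam g : ℝ) : ℝ :=
  if g < 0 then 0
  else if g < sys.Gmax then
    1 - (1 - sys.eff) /
      (2 * (1 - sys.eff * Real.exp (-(1 / sys.ac - sys.ad) * lam * sys.Smax / 2))) *
        Real.exp (-lam * g)
  else 1

end StorageSystem

/-! ### Tails of the Laplace distribution. -/

section Laplace

variable {lam : ℝ}

/-! Write β for `decayRate`, γ for `meanRate` and a for `atomZero`, so that γ + β = λ/α_c and γ - β
= λα_d. Laplace tails are exponential: for 0 ≤ t < Smax, one step from s ≤ t ends above t with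
probability e^{-(γ+β)(t-s)}/2, and one step from s > t ends at or below t with probability
e^{-(γ-β)(s-t)}/2. Weighted by the density aγe^{-βs}, these become integrals of e^{γs} and e^{-γs}.
Atoms a at 0 and ae^{-βSmax} at Smax cancel the boundary terms at the two ends, and the upward and
downward flux across t both equal ae^{-βt}/2. This balance (`integral_stepCDF`) preserves the cdf,
hence the law (`invariant_stationaryLaw`). Total mass one fixes a, through γ/β = (1+α)/(1-α).

Uniqueness is a Doeblin argument: a sufficiently negative error empties the storage from every
level, so all transition probabilities dominate the same positive multiple of the Dirac mass at 0
(`Kernel.Invariant.eq_of_minorization`, `invariant_unique`).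

For 0 ≤ g < Gmax, generation exceeds g with probability e^{-λg} E[e^{-λα_d S}]/2, and the
expectation is 2a under the stationary law (`integral_generation_cdf`). For the sequence itself, `S
i` is independent of `Δ i`, so the kernel carries the law of `S i` to that of `S (i + 1)`
(`IsStoredPower.map_succ`). -/

instance instNullSingletonClassLaplaceMeasure : NullSingletonClass (laplaceMeasure lam) := by
  unfold laplaceMeasure; infer_instance

theorem laplaceMeasure_Iic_of_nonpos (hlam : 0 < lam) {x : ℝ} (hx : x ≤ 0) :
    laplaceMeasure lam (Set.Iic x) = ENNReal.ofReal (Real.exp (lam * x) / 2) := by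
  have h : Set.EqOn (fun y => ENNReal.ofReal (lam / 2 * Real.exp (-lam * |y|)))
      (fun y => ENNReal.ofReal (lam / 2 * Real.exp (lam * y))) (Set.Iic x) := by
    intro y hy
    simp [abs_of_nonpos (le_trans hy hx)]
  rw [laplaceMeasure, withDensity_apply _ measurableSet_Iic,
    setLIntegral_congr_fun measurableSet_Iic h,
    ← ofReal_integral_eq_lintegral_ofReal ((integrableOn_exp_mul_Iic hlam x).const_mul _)
      (ae_of_all _ fun y => by positivity), integral_const_mul, integral_exp_mul_Iic hlam]
  congr 1
  field_simp

theorem laplaceMeasure_Ioi_of_nonneg (hlam : 0 < lam) {x : ℝ} (hx : 0 ≤ x) :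
    laplaceMeasure lam (Set.Ioi x) = ENNReal.ofReal (Real.exp (-lam * x) / 2) := by
  have h : Set.EqOn (fun y => ENNReal.ofReal (lam / 2 * Real.exp (-lam * |y|)))
      (fun y => ENNReal.ofReal (lam / 2 * Real.exp (-lam * y))) (Set.Ioi x) := by
    intro y hy
    simp [abs_of_nonneg (le_trans hx (le_of_lt hy))]
  rw [laplaceMeasure, withDensity_apply _ measurableSet_Ioi,
    setLIntegral_congr_fun measurableSet_Ioi h,
    ← ofReal_integral_eq_lintegral_ofReal
      ((integrableOn_exp_mul_Ioi (neg_lt_zero.2 hlam) x).const_mul _)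
      (ae_of_all _ fun y => by positivity), integral_const_mul,
    integral_exp_mul_Ioi (neg_lt_zero.2 hlam)]
  congr 1
  field_simp

theorem isProbabilityMeasure_laplaceMeasure (hlam : 0 < lam) :
    IsProbabilityMeasure (laplaceMeasure lam) := by
  constructor
  rw [← Set.Iic_union_Ioi (a := (0 : ℝ)),
    measure_union (Set.Iic_disjoint_Ioi le_rfl) measurableSet_Ioi,
    laplaceMeasure_Iic_of_nonpos hlam le_rfl, laplaceMeasure_Ioi_of_nonneg hlam le_rfl,
    ← ENNReal.ofReal_add (by positivity) (by positivity)]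
  norm_num

theorem laplaceMeasure_Iic_of_nonneg (hlam : 0 < lam) {x : ℝ} (hx : 0 ≤ x) :
    laplaceMeasure lam (Set.Iic x) = ENNReal.ofReal (1 - Real.exp (-lam * x) / 2) := by
  have := isProbabilityMeasure_laplaceMeasure hlam
  rw [← Set.compl_Ioi, prob_compl_eq_one_sub measurableSet_Ioi,
    laplaceMeasure_Ioi_of_nonneg hlam hx, ENNReal.ofReal_sub _ (by positivity), ENNReal.ofReal_one]

theorem laplaceMeasure_Ici_of_nonpos (hlam : 0 < lam) {x : ℝ} (hx : x ≤ 0) :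
    laplaceMeasure lam (Set.Ici x) = ENNReal.ofReal (1 - Real.exp (lam * x) / 2) := by
  have := isProbabilityMeasure_laplaceMeasure hlam
  rw [← Set.compl_Iio, prob_compl_eq_one_sub measurableSet_Iio,
    measure_congr Iio_ae_eq_Iic,
    laplaceMeasure_Iic_of_nonpos hlam hx, ENNReal.ofReal_sub _ (by positivity), ENNReal.ofReal_one]

end Laplace

/-! ### Uniqueness of invariant laws under minorization. -/

namespace ProbabilityTheory.Kernel

/-- A Markov kernel whose transition probabilities dominate a fixed nonzero measure has at most
one invariant probability measure. -/
theorem Invariant.eq_of_minorization {α : Type*} [MeasurableSpace α] {κ : Kernel α α}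
    [IsMarkovKernel κ] {ρ : Measure α} (hρ : ρ ≠ 0) (hκ : ∀ x, ρ ≤ κ x) {μ ν : Measure α}
    [IsProbabilityMeasure μ] [IsProbabilityMeasure ν] (hμ : κ.Invariant μ) (hν : κ.Invariant ν) :
    μ = ν := by
  set m := μ ⊓ ν with hm
  have hmμ : m ≤ μ := inf_le_left
  have hmν : m ≤ ν := inf_le_right
  have : IsFiniteMeasure m := isFiniteMeasure_of_le μ hmμ
  have bind_univ (ξ : Measure α) : ξ.bind κ Set.univ = ξ Set.univ := by
    simp [Measure.bind_apply .univ κ.aemeasurable]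
  have bind_mono {ξ η : Measure α} (h : ξ ≤ η) : ξ.bind κ ≤ η.bind κ := by
    refine Measure.le_iff.2 fun s hs => ?_
    rw [Measure.bind_apply hs κ.aemeasurable, Measure.bind_apply hs κ.aemeasurable]
    exact lintegral_mono' h le_rfl
  -- The image of `m` lies below `μ` and `ν`, hence below `m`; as `κ` preserves total mass, equality
  -- holds.
  have hminv : m.bind κ = m := by
    refine Measure.eq_of_le_of_measure_univ_eq
      (le_inf ((bind_mono hmμ).trans_eq hμ) ((bind_mono hmν).trans_eq hν)) (bind_univ m)
  -- The kernel fixes `m` and sends the remainder `ξ - m`, of mass `1 - m Set.univ`, to at least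
  -- that multiple of `ρ`.
  have le_of_inv {ξ : Measure α} [IsProbabilityMeasure ξ] (hmξ : m ≤ ξ) (hξ : κ.Invariant ξ) :
      m + (1 - m Set.univ) • ρ ≤ ξ := by
    have hadd := Measure.sub_add_cancel_of_le hmξ
    have huniv : (ξ - m) Set.univ = 1 - m Set.univ := by
      rw [Measure.sub_apply .univ hmξ, measure_univ]
    refine Measure.le_iff.2 fun s hs => ?_
    have h1 : ξ s = ∫⁻ x, κ x s ∂(ξ - m) + m s := by
      conv_lhs => rw [← hξ.def, ← hadd]
      rw [Measure.bind_apply hs κ.aemeasurable, lintegral_add_measure,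
        ← Measure.bind_apply hs κ.aemeasurable (m := m), hminv]
    have h2 : (1 - m Set.univ) * ρ s ≤ ∫⁻ x, κ x s ∂(ξ - m) := by
      calc (1 - m Set.univ) * ρ s = ∫⁻ _, ρ s ∂(ξ - m) := by
            rw [MeasureTheory.lintegral_const, huniv, mul_comm]
        _ ≤ _ := lintegral_mono fun x => hκ x s
    rw [h1, add_comm, Measure.add_apply]
    exact add_le_add h2 le_rfl
  -- A common lower bound of `μ` and `ν` lies below their infimum `m`; since `m` is finite and `ρ ≠
  -- 0`, the added multiple of `ρ` must vanish.
  have hle : m + (1 - m Set.univ) • ρ ≤ m := le_inf (le_of_inv hmμ hμ) (le_of_inv hmν hν)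
  have hzero : (1 - m Set.univ) * ρ Set.univ = 0 := by
    have := hle Set.univ
    simp only [Measure.add_apply, Measure.smul_apply, smul_eq_mul] at this
    by_contra h
    exact absurd this (not_le.2 (ENNReal.lt_add_right (measure_ne_top _ _) h))
  have hmuniv : m Set.univ = 1 := by
    rcases mul_eq_zero.1 hzero with h | h
    · exact le_antisymm ((hmμ _).trans_eq measure_univ) (tsub_eq_zero_iff_le.1 h)
    · exact absurd (Measure.measure_univ_eq_zero.1 h) hρ
  rw [← Measure.eq_of_le_of_measure_univ_eq hmμ (by simp [hmuniv]),
    ← Measure.eq_of_le_of_measure_univ_eq hmν (by simp [hmuniv])]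

end ProbabilityTheory.Kernel

/-! ### Regrouping independent variables; integrals of piecewise functions. -/

theorem ProbabilityTheory.IndepFun.prodMk_left_of_indepFun_prodMk {Ω α β γ : Type*}
    [MeasurableSpace Ω] [MeasurableSpace α] [MeasurableSpace β] [MeasurableSpace γ] {P : Measure Ω}
    [IsProbabilityMeasure P] {X : Ω → α} {Y : Ω → β} {Z : Ω → γ} (hX : Measurable X)
    (hY : Measurable Y) (hZ : Measurable Z) (hXYZ : IndepFun X (fun ω => (Y ω, Z ω)) P)
    (hYZ : IndepFun Y Z P) : IndepFun (fun ω => (X ω, Y ω)) Z P := by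
  have := Measure.isProbabilityMeasure_map (μ := P) hX.aemeasurable
  have := Measure.isProbabilityMeasure_map (μ := P) hY.aemeasurable
  have := Measure.isProbabilityMeasure_map (μ := P) hZ.aemeasurable
  have hXY : IndepFun X Y P := hXYZ.comp measurable_id measurable_fst
  rw [indepFun_iff_map_prod_eq_prod_map_map hX.aemeasurable (by fun_prop),
    (indepFun_iff_map_prod_eq_prod_map_map hY.aemeasurable hZ.aemeasurable).1 hYZ] at hXYZ
  -- The joint law of the triple is a threefold product, so reassociating it gives the other
  -- grouping.
  rw [indepFun_iff_map_prod_eq_prod_map_map (by fun_prop) hZ.aemeasurable,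
    (indepFun_iff_map_prod_eq_prod_map_map hX.aemeasurable hY.aemeasurable).1 hXY,
    ← (measurePreserving_prodAssoc (P.map X) (P.map Y) (P.map Z)).symm.map_eq, ← hXYZ,
    Measure.map_map (by fun_prop) (by fun_prop)]
  rfl

theorem integral_exp_mul_real {c : ℝ} (hc : c ≠ 0) (a b : ℝ) :
    ∫ x in a..b, Real.exp (c * x) = (Real.exp (c * b) - Real.exp (c * a)) / c := by
  rw [intervalIntegral.integral_comp_mul_left (fun x => Real.exp x) hc, integral_exp, smul_eq_mul,
    inv_mul_eq_div]

theorem intervalIntegrable_ite_le {u v : ℝ → ℝ} (hu : Continuous u) (hv : Continuous v)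
    {a t b : ℝ} (hat : a ≤ t) (htb : t ≤ b) :
    IntervalIntegrable (fun x => if x ≤ t then u x else v x) volume a b := by
  refine IntervalIntegrable.trans (b := t) ?_ ?_
  · refine (hu.intervalIntegrable a t).congr fun x hx => ?_
    rw [Set.uIoc_of_le hat] at hx
    simp [hx.2]
  · refine (hv.intervalIntegrable t b).congr fun x hx => ?_
    rw [Set.uIoc_of_le htb] at hx
    simp [hx.1]

theorem integral_ite_le {u v : ℝ → ℝ} (hu : Continuous u) (hv : Continuous v)
    {a t b : ℝ} (hat : a ≤ t) (htb : t ≤ b) :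
    ∫ x in a..b, (if x ≤ t then u x else v x) = (∫ x in a..t, u x) + ∫ x in t..b, v x := by
  have h := intervalIntegrable_ite_le hu hv hat htb
  rw [← intervalIntegral.integral_add_adjacent_intervals
    (intervalIntegrable_ite_le hu hv hat le_rfl)
    (h.mono_set (by rw [Set.uIcc_of_le htb, Set.uIcc_of_le (hat.trans htb)]
                    exact Set.Icc_subset_Icc_left hat))]
  congr 1
  · refine intervalIntegral.integral_congr_ae (ae_of_all _ fun x hx => ?_)
    rw [Set.uIoc_of_le hat] at hx
    simp [hx.2]
  · refine intervalIntegral.integral_congr_ae (ae_of_all _ fun x hx => ?_)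
    rw [Set.uIoc_of_le htb] at hx
    simp [hx.1]

/-! ### One step of the chain. -/

namespace StorageSystem

variable (sys : StorageSystem) {lam : ℝ}

/-- The generator never affects the stored power, so the five cases of the policy reduce to charging
clipped at `Smax` and discharging clipped at 0. -/
theorem next_eq_ite (s : sys.Level) (d : ℝ) :
    sys.next s d = if 0 ≤ d then min sys.Smax (s + sys.ac * d) else max 0 (s + d / sys.ad) := by
  obtain ⟨s, h0, h1⟩ := s
  have hc := sys.ac_pos
  have hd := sys.ad_pos
  have hM : 0 ≤ (sys.Smax - s) / sys.ac := div_nonneg (by linarith) hc.le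
  have e1 : sys.ac * ((sys.Smax - s) / sys.ac) = sys.Smax - s := by field_simp
  have e2 : sys.ad * s / sys.ad = s := by field_simp
  simp only [next, policy]
  by_cases h2 : (sys.Smax - s) / sys.ac ≤ d
  · have := (div_le_iff₀ hc).1 h2
    simp only [h2, hM.trans h2, if_true, e1]
    rw [min_eq_left (by linarith)]
    simp
  by_cases h3 : 0 ≤ d
  · have := (lt_div_iff₀ hc).1 (not_le.1 h2)
    simp only [h2, h3, if_true, if_false]
    rw [min_eq_right (by linarith)]
    simp
  by_cases h4 : -sys.ad * s ≤ d
  · have : -s ≤ d / sys.ad := (le_div_iff₀ hd).2 (by linarith)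
    simp only [h2, h3, h4, if_true, if_false]
    rw [max_eq_right (by linarith)]
    ring
  · have : d / sys.ad ≤ -s := (div_le_iff₀ hd).2 (by linarith)
    simp only [h2, h3, h4, if_false]
    rw [max_eq_left (by linarith)]
    split_ifs <;> simp [e2]

/-- Neither clipping matters for `0 ≤ t < Smax`. The threshold is the error that moves the level
from `s` exactly to `t`, with slope `1 / ac` or `ad` according to the direction. -/
theorem next_le_iff (s : sys.Level) (d : ℝ) {t : ℝ} (h0 : 0 ≤ t) (ht : t < sys.Smax) :
    sys.next s d ≤ t ↔
      d ≤ if (s : ℝ) ≤ t then (t - s) / sys.ac else -(sys.ad * (s - t)) := by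
  have hc := sys.ac_pos
  have hd := sys.ad_pos
  rw [next_eq_ite]
  split_ifs with h1 h2 h2
  · rw [min_le_iff, le_div_iff₀ hc]
    constructor
    · rintro (h | h) <;> linarith
    · intro h; right; linarith
  · have : 0 ≤ sys.ac * d := by positivity
    have : 0 < sys.ad * (s - t) := mul_pos hd (by linarith)
    rw [min_le_iff]
    constructor
    · rintro (h | h) <;> linarith
    · intro h; linarith
  · have : d / sys.ad ≤ 0 := div_nonpos_of_nonpos_of_nonneg (by linarith) hd.le
    have : 0 ≤ (t - s) / sys.ac := div_nonneg (by linarith) hc.le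
    exact iff_of_true (max_le h0 (by linarith)) (by linarith)
  · rw [max_le_iff, ← le_sub_iff_add_le', div_le_iff₀ hd]
    constructor
    · rintro ⟨-, h⟩; linarith
    · intro h; exact ⟨h0, by linarith⟩

/-- An error of `-(ad * Smax)` already drains a full storage; the extra 1 keeps `d` strictly
negative when `Smax = 0`. -/
theorem next_eq_zero (s : sys.Level) {d : ℝ} (hd : d ≤ -(sys.ad * sys.Smax + 1)) :
    sys.next s d = 0 := by
  have h1 := mul_nonneg sys.ad_pos.le sys.Smax_nonneg
  have h2 := mul_le_mul_of_nonneg_left s.2.2 sys.ad_pos.le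
  have h3 : d / sys.ad ≤ -s := (div_le_iff₀ sys.ad_pos).2 (by linarith)
  rw [next_eq_ite, if_neg (by linarith), max_eq_left (by linarith)]

theorem measurable_generation :
    Measurable fun p : sys.Level × ℝ => sys.generation p.1 p.2 := by
  simp only [generation, policy, apply_ite ControlAction.gen]
  have hd : Measurable fun p : sys.Level × ℝ => p.2 := measurable_snd
  exact .ite (measurableSet_le (by fun_prop) hd) (by fun_prop)
    (.ite (measurableSet_le (by fun_prop) hd) (by fun_prop)
      (.ite (measurableSet_le (by fun_prop) hd) (by fun_prop)
        (.ite (measurableSet_le (by fun_prop) hd) (by fun_prop) (by fun_prop))))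

theorem generation_nonneg (s : sys.Level) (d : ℝ) : 0 ≤ sys.generation s d := by
  have := sys.Gmax_nonneg
  simp only [generation, policy]
  split_ifs <;> simp only <;> linarith

theorem generation_le_Gmax (s : sys.Level) (d : ℝ) : sys.generation s d ≤ sys.Gmax := by
  have := sys.Gmax_nonneg
  simp only [generation, policy]
  split_ifs <;> simp only <;> linarith

theorem generation_le_iff (s : sys.Level) (d : ℝ) {g : ℝ} (h0 : 0 ≤ g) (hg : g < sys.Gmax) :
    sys.generation s d ≤ g ↔ -(g + sys.ad * s) ≤ d := by
  have h1 : 0 ≤ sys.ad * s := mul_nonneg sys.ad_pos.le s.2.1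
  have h2 : 0 ≤ (sys.Smax - s) / sys.ac := div_nonneg (by linarith [s.2.2]) sys.ac_pos.le
  simp only [generation, policy]
  split_ifs <;> simp only <;> constructor <;> intro h <;> linarith

theorem isMarkovKernel_kernel (hlam : 0 < lam) : IsMarkovKernel (sys.kernel lam) := by
  have := isProbabilityMeasure_laplaceMeasure hlam
  exact ⟨fun s => Measure.isProbabilityMeasure_map
    (sys.measurable_step.comp measurable_prodMk_left).aemeasurable⟩

theorem kernel_apply (s : sys.Level) {t : Set sys.Level} (ht : MeasurableSet t) :
    sys.kernel lam s t = laplaceMeasure lam {d | sys.step s d ∈ t} :=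
  Measure.map_apply (sys.measurable_step.comp measurable_prodMk_left) ht

/-- The probability that the stored power is at most `t` after one step from `s`. -/
noncomputable def stepCDF (lam t s : ℝ) : ℝ :=
  if s ≤ t then 1 - Real.exp (-(lam / sys.ac * (t - s))) / 2
  else Real.exp (-(lam * sys.ad * (s - t))) / 2

theorem kernel_Iic (hlam : 0 < lam) (s : sys.Level) {t : ℝ} (h0 : 0 ≤ t) (ht : t < sys.Smax) :
    sys.kernel lam s (Subtype.val ⁻¹' Set.Iic t) = ENNReal.ofReal (sys.stepCDF lam t s) := by
  have hset : {d | sys.step s d ∈ Subtype.val ⁻¹' Set.Iic t} =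
      Set.Iic (if (s : ℝ) ≤ t then (t - s) / sys.ac else -(sys.ad * (s - t))) :=
    Set.ext fun d => sys.next_le_iff s d h0 ht
  rw [kernel_apply sys s (measurable_subtype_coe measurableSet_Iic), hset, stepCDF]
  split_ifs with h
  · rw [laplaceMeasure_Iic_of_nonneg hlam (div_nonneg (by linarith) sys.ac_pos.le)]
    congr 4
    ring
  · rw [laplaceMeasure_Iic_of_nonpos hlam
      (neg_nonpos.2 (mul_nonneg sys.ad_pos.le (by linarith)))]
    congr 3
    ring

theorem invariant_unique (hlam : 0 < lam) {μ ν : Measure sys.Level} [IsProbabilityMeasure μ]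
    [IsProbabilityMeasure ν] (hμ : (sys.kernel lam).Invariant μ)
    (hν : (sys.kernel lam).Invariant ν) : μ = ν := by
  have := isMarkovKernel_kernel sys hlam
  have hx : -(sys.ad * sys.Smax + 1) ≤ 0 := by
    linarith [mul_nonneg sys.ad_pos.le sys.Smax_nonneg]
  set c := laplaceMeasure lam (Set.Iic (-(sys.ad * sys.Smax + 1))) with hc
  have hc0 : c ≠ 0 := by
    rw [hc, laplaceMeasure_Iic_of_nonpos hlam hx]
    simp [Real.exp_pos]
  refine Kernel.Invariant.eq_of_minorization
    (ρ := c • Measure.dirac (⟨0, le_rfl, sys.Smax_nonneg⟩ : sys.Level)) ?_ (fun s => ?_) hμ hν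
  · intro h
    have := congrArg (fun m : Measure sys.Level => m Set.univ) h
    simp [hc0] at this
  · refine Measure.le_iff.2 fun t ht => ?_
    rw [kernel_apply sys s ht, Measure.smul_apply, Measure.dirac_apply' _ ht, smul_eq_mul]
    by_cases h : (⟨0, le_rfl, sys.Smax_nonneg⟩ : sys.Level) ∈ t
    · rw [Set.indicator_of_mem h, Pi.one_apply, mul_one, hc]
      refine measure_mono fun d hd => ?_
      have : sys.step s d = ⟨0, le_rfl, sys.Smax_nonneg⟩ := Subtype.ext (sys.next_eq_zero s hd)
      simpa [this] using h
    · simp [Set.indicator_of_notMem h]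

theorem bind_kernel_eq_map_prod (hlam : 0 < lam) (μ : Measure sys.Level) [SFinite μ] :
    μ.bind (sys.kernel lam) =
      (μ.prod (laplaceMeasure lam)).map fun p => sys.step p.1 p.2 := by
  have := isProbabilityMeasure_laplaceMeasure hlam
  ext t ht
  rw [Measure.bind_apply ht (Kernel.aemeasurable _), Measure.map_apply sys.measurable_step ht,
    Measure.prod_apply (sys.measurable_step ht)]
  exact lintegral_congr fun s => kernel_apply sys s ht

theorem generationLaw_Iic (hlam : 0 < lam) (μ : Measure sys.Level) [SFinite μ] {g : ℝ}
    (h0 : 0 ≤ g) (hg : g < sys.Gmax) :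
    sys.generationLaw lam μ (Set.Iic g) =
      ∫⁻ s, ENNReal.ofReal (1 - Real.exp (-(lam * (g + sys.ad * s))) / 2) ∂μ := by
  have := isProbabilityMeasure_laplaceMeasure hlam
  rw [generationLaw, Measure.map_apply sys.measurable_generation measurableSet_Iic,
    Measure.prod_apply (sys.measurable_generation measurableSet_Iic)]
  refine lintegral_congr fun s => ?_
  have hset : Prod.mk s ⁻¹' ((fun p : sys.Level × ℝ => sys.generation p.1 p.2) ⁻¹' Set.Iic g) =
      Set.Ici (-(g + sys.ad * s)) :=
    Set.ext fun d => sys.generation_le_iff s d h0 hg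
  have hs := mul_nonneg sys.ad_pos.le s.2.1
  rw [hset, laplaceMeasure_Ici_of_nonpos hlam (by linarith), mul_neg]

theorem isProbabilityMeasure_generationLaw (hlam : 0 < lam) (μ : Measure sys.Level)
    [IsProbabilityMeasure μ] : IsProbabilityMeasure (sys.generationLaw lam μ) := by
  have := isProbabilityMeasure_laplaceMeasure hlam
  exact Measure.isProbabilityMeasure_map sys.measurable_generation.aemeasurable

/-! ### Laws along the stored power sequence. -/

namespace IsStoredPower

variable {sys} {Ω : Type*} [MeasurableSpace Ω] {P : Measure Ω} {Δ : ℕ → Ω → ℝ}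
  {S : ℕ → Ω → sys.Level}

/-- The stored power at time `i` is a function of the initial level and the first `i` errors. -/
theorem exists_eq_comp (h : sys.IsStoredPower lam P Δ S) (i : ℕ) :
    ∃ f : sys.Level × (Finset.range i → ℝ) → sys.Level, Measurable f ∧
      ∀ ω, S i ω = f (S 0 ω, fun j => Δ j ω) := by
  induction i with
  | zero => exact ⟨Prod.fst, measurable_fst, fun ω => rfl⟩
  | succ i ih =>
    obtain ⟨f, hf, hS⟩ := ih
    refine ⟨fun p => sys.step (f (p.1, fun j => p.2 ⟨j, Finset.mem_range.2
      ((Finset.mem_range.1 j.2).trans i.lt_succ_self)⟩)) (p.2 ⟨i, Finset.self_mem_range_succ i⟩),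
      ?_, fun ω => ?_⟩
    · exact sys.measurable_step.comp (.prodMk (hf.comp (by fun_prop)) (by fun_prop))
    · rw [h.succ, hS]

theorem measurable (h : sys.IsStoredPower lam P Δ S) (i : ℕ) : Measurable (S i) := by
  induction i with
  | zero => exact h.measurable_init
  | succ i ih =>
    rw [show S (i + 1) = fun ω => sys.step (S i ω) (Δ i ω) from funext (h.succ i)]
    exact sys.measurable_step.comp (ih.prodMk (h.measurable_error i))

variable [IsProbabilityMeasure P]

/-- `S i` depends only on `S 0` and the errors of index below `i`, and these are jointly independent
of `Δ i`. -/
theorem indepFun_error (h : sys.IsStoredPower lam P Δ S) (i : ℕ) : IndepFun (S i) (Δ i) P := by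
  obtain ⟨f, hf, hS⟩ := h.exists_eq_comp i
  have hΔ := h.measurable_error
  have h1 : IndepFun (fun ω (j : Finset.range i) => Δ j ω) (Δ i) P :=
    (h.iIndep_error.indepFun_finset (Finset.range i) {i} (by simp) hΔ).comp measurable_id
      (measurable_pi_apply (⟨i, Finset.mem_singleton_self i⟩ : ({i} : Finset ℕ)))
  have h2 : IndepFun (S 0) (fun ω => (fun (j : Finset.range i) => Δ j ω, Δ i ω)) P :=
    h.indep_init.comp (ψ := fun x : ℕ → ℝ => (fun (j : Finset.range i) => x j, x i))
      measurable_id (by fun_prop)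
  have h3 := (h2.prodMk_left_of_indepFun_prodMk h.measurable_init (by fun_prop) (hΔ i) h1).comp
    hf measurable_id
  rwa [show S i = f ∘ fun ω => (S 0 ω, fun j : Finset.range i => Δ j ω) from funext hS]

theorem map_prodMk (h : sys.IsStoredPower lam P Δ S) (i : ℕ) :
    P.map (fun ω => (S i ω, Δ i ω)) = (P.map (S i)).prod (laplaceMeasure lam) := by
  rw [← h.law_error i]
  exact (indepFun_iff_map_prod_eq_prod_map_map (h.measurable i).aemeasurable
    (h.measurable_error i).aemeasurable).1 (h.indepFun_error i)

theorem map_succ (h : sys.IsStoredPower lam P Δ S) (hlam : 0 < lam) (i : ℕ) :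
    P.map (S (i + 1)) = (P.map (S i)).bind (sys.kernel lam) := by
  rw [bind_kernel_eq_map_prod sys hlam, ← h.map_prodMk i,
    Measure.map_map sys.measurable_step ((h.measurable i).prodMk (h.measurable_error i))]
  exact congrArg (P.map ·) (funext (h.succ i))

theorem map_generation (h : sys.IsStoredPower lam P Δ S) (i : ℕ) :
    P.map (fun ω => sys.generation (S i ω) (Δ i ω)) = sys.generationLaw lam (P.map (S i)) := by
  rw [generationLaw, ← h.map_prodMk i, Measure.map_map sys.measurable_generation
    ((h.measurable i).prodMk (h.measurable_error i))]
  rfl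

end IsStoredPower

end StorageSystem

/-! ### The stationary law: mass, cdf and atoms. -/

namespace StorageSystem

variable (sys : StorageSystem) (lam : ℝ)

/-- The decay rate of the density of the stationary stored power. -/
noncomputable def decayRate : ℝ := (1 / sys.ac - sys.ad) * lam / 2

/-- The mean of the rates `lam / ac` and `lam * ad` of upward and downward moves. -/
noncomputable def meanRate : ℝ := (1 / sys.ac + sys.ad) * lam / 2

/-- The mass of the stationary stored power at `0`. -/
noncomputable def atomZero : ℝ :=
  (1 - sys.eff) / (2 * (1 - sys.eff * Real.exp (-(1 / sys.ac - sys.ad) * lam * sys.Smax / 2)))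

/-- The mass of the stationary stored power at `Smax`. -/
noncomputable def atomMax : ℝ := sys.atomZero lam * Real.exp (-(sys.decayRate lam) * sys.Smax)

/-- The density of the stationary stored power on the interior of `[0, Smax]`. -/
noncomputable def interiorDensity (s : ℝ) : ℝ :=
  sys.atomZero lam * sys.meanRate lam * Real.exp (-(sys.decayRate lam) * s)

/-- The stationary distribution of the stored power. -/
noncomputable def stationaryLaw : Measure sys.Level :=
  ENNReal.ofReal (sys.atomZero lam) • Measure.dirac ⟨0, le_rfl, sys.Smax_nonneg⟩ +
    ENNReal.ofReal (sys.atomMax lam) • Measure.dirac ⟨sys.Smax, sys.Smax_nonneg, le_rfl⟩ +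
    ((volume.restrict (Set.Ioc 0 sys.Smax)).withDensity
      fun s => ENNReal.ofReal (sys.interiorDensity lam s)).map
        (Set.projIcc 0 sys.Smax sys.Smax_nonneg)

theorem eff_pos : 0 < sys.eff := mul_pos sys.ac_pos sys.ad_pos

theorem eff_lt_one : sys.eff < 1 := by
  have := mul_lt_mul'' sys.ac_lt_one sys.ad_lt_one sys.ac_pos.le sys.ad_pos.le
  simpa [eff] using this

theorem meanRate_add_decayRate : sys.meanRate lam + sys.decayRate lam = lam / sys.ac := by
  simp only [meanRate, decayRate]; ring

theorem meanRate_sub_decayRate : sys.meanRate lam - sys.decayRate lam = lam * sys.ad := by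
  simp only [meanRate, decayRate]; ring

/-- Gives the ratio γ/β = (1+α)/(1-α), which turns the integrated density into an expression in
`eff`. -/
theorem meanRate_mul_one_sub_eff :
    sys.meanRate lam * (1 - sys.eff) = sys.decayRate lam * (1 + sys.eff) := by
  have := sys.ac_pos.ne'
  simp only [meanRate, decayRate, eff]; field_simp

theorem exp_decayRate (s : ℝ) : Real.exp (-(1 / sys.ac - sys.ad) * lam * s / 2) =
    Real.exp (-(sys.decayRate lam) * s) := by
  congr 1; simp only [decayRate]; ring

variable {lam}

theorem decayRate_pos (hlam : 0 < lam) : 0 < sys.decayRate lam := by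
  have : 1 < 1 / sys.ac := (one_lt_div sys.ac_pos).2 sys.ac_lt_one
  have := mul_pos (sub_pos.2 (sys.ad_lt_one.trans this)) hlam
  simp only [decayRate]; linarith

theorem meanRate_pos (hlam : 0 < lam) : 0 < sys.meanRate lam := by
  have := sys.ac_pos
  have := sys.ad_pos
  simp only [meanRate]; positivity

theorem one_sub_eff_mul_exp_pos (hlam : 0 < lam) :
    0 < 1 - sys.eff * Real.exp (-(sys.decayRate lam) * sys.Smax) := by
  have h : Real.exp (-(sys.decayRate lam) * sys.Smax) ≤ 1 := by
    rw [Real.exp_le_one_iff, neg_mul]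
    exact neg_nonpos.2 (mul_nonneg (sys.decayRate_pos hlam).le sys.Smax_nonneg)
  nlinarith [sys.eff_pos, sys.eff_lt_one]

theorem atomZero_mul (hlam : 0 < lam) :
    sys.atomZero lam * (2 * (1 - sys.eff * Real.exp (-(sys.decayRate lam) * sys.Smax))) =
      1 - sys.eff := by
  rw [atomZero, exp_decayRate]
  exact div_mul_cancel₀ _ (by linarith [sys.one_sub_eff_mul_exp_pos hlam])

theorem atomZero_pos (hlam : 0 < lam) : 0 < sys.atomZero lam := by
  rw [atomZero, exp_decayRate]
  exact div_pos (sub_pos.2 sys.eff_lt_one) (by linarith [sys.one_sub_eff_mul_exp_pos hlam])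

theorem atomMax_pos (hlam : 0 < lam) : 0 < sys.atomMax lam :=
  mul_pos (sys.atomZero_pos hlam) (Real.exp_pos _)

theorem interiorDensity_pos (hlam : 0 < lam) (s : ℝ) : 0 < sys.interiorDensity lam s :=
  mul_pos (mul_pos (sys.atomZero_pos hlam) (sys.meanRate_pos hlam)) (Real.exp_pos _)

theorem continuous_interiorDensity : Continuous (sys.interiorDensity lam) := by
  unfold interiorDensity; fun_prop

/-- Integration of a nonnegative function against the stationary distribution. -/
theorem lintegral_stationaryLaw (hlam : 0 < lam) {h : ℝ → ℝ} (hm : Measurable h)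
    (h0 : ∀ s ∈ Set.Icc 0 sys.Smax, 0 ≤ h s)
    (hi : IntervalIntegrable (fun s => sys.interiorDensity lam s * h s) volume 0 sys.Smax) :
    ∫⁻ s, ENNReal.ofReal (h s) ∂(sys.stationaryLaw lam) =
      ENNReal.ofReal (sys.atomZero lam * h 0 + sys.atomMax lam * h sys.Smax +
        ∫ s in 0..sys.Smax, sys.interiorDensity lam s * h s) := by
  have hM := sys.Smax_nonneg
  have hmeas : Measurable fun s : sys.Level => ENNReal.ofReal (h s) := by fun_prop
  have hproj : Measurable (Set.projIcc 0 sys.Smax hM) := continuous_projIcc.measurable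
  have hz := mul_nonneg (sys.atomZero_pos hlam).le (h0 0 ⟨le_rfl, hM⟩)
  have hx := mul_nonneg (sys.atomMax_pos hlam).le (h0 sys.Smax ⟨hM, le_rfl⟩)
  have hnn : ∀ᵐ s ∂(volume.restrict (Set.Ioc 0 sys.Smax)), 0 ≤ sys.interiorDensity lam s * h s :=
    (ae_restrict_iff' measurableSet_Ioc).2 (ae_of_all _ fun s hs =>
      mul_nonneg (sys.interiorDensity_pos hlam s).le (h0 s (Set.Ioc_subset_Icc_self hs)))
  have hint : ∫⁻ s, ENNReal.ofReal (h (Set.projIcc 0 sys.Smax hM s))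
      ∂((volume.restrict (Set.Ioc 0 sys.Smax)).withDensity
        fun s => ENNReal.ofReal (sys.interiorDensity lam s)) =
      ENNReal.ofReal (∫ s in 0..sys.Smax, sys.interiorDensity lam s * h s) := by
    rw [lintegral_withDensity_eq_lintegral_mul
      (g := fun s => ENNReal.ofReal (h (Set.projIcc 0 sys.Smax hM s))) _
      (sys.continuous_interiorDensity.measurable.ennreal_ofReal) (hmeas.comp hproj),
      intervalIntegral.integral_of_le hM, ofReal_integral_eq_lintegral_ofReal
        ((intervalIntegrable_iff_integrableOn_Ioc_of_le hM).1 hi) hnn]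
    refine setLIntegral_congr_fun measurableSet_Ioc fun s hs => ?_
    simp only [Pi.mul_apply]
    -- The projection only serves to land in the subtype: it is the identity where the density
    -- lives.
    rw [Set.projIcc_of_mem hM (Set.Ioc_subset_Icc_self hs),
      ENNReal.ofReal_mul (sys.interiorDensity_pos hlam s).le]
  rw [stationaryLaw, lintegral_add_measure, lintegral_add_measure, lintegral_smul_measure,
    lintegral_smul_measure, lintegral_dirac' _ hmeas, lintegral_dirac' _ hmeas,
    lintegral_map hmeas hproj, hint, smul_eq_mul, smul_eq_mul,
    ← ENNReal.ofReal_mul (sys.atomZero_pos hlam).le,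
    ← ENNReal.ofReal_mul (sys.atomMax_pos hlam).le, ← ENNReal.ofReal_add hz hx,
    ← ENNReal.ofReal_add (add_nonneg hz hx)]
  rw [intervalIntegral.integral_of_le hM]
  exact integral_nonneg_of_ae hnn

theorem integral_interiorDensity (hlam : 0 < lam) (a b : ℝ) :
    ∫ s in a..b, sys.interiorDensity lam s =
      sys.atomZero lam * sys.meanRate lam * (Real.exp (-(sys.decayRate lam) * a) -
        Real.exp (-(sys.decayRate lam) * b)) / sys.decayRate lam := by
  have hβ := (sys.decayRate_pos hlam).ne'
  simp only [interiorDensity]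
  rw [intervalIntegral.integral_const_mul, integral_exp_mul_real (neg_ne_zero.2 hβ)]
  field_simp
  ring

theorem stationary_total_mass (hlam : 0 < lam) :
    sys.atomZero lam + sys.atomMax lam + ∫ s in 0..sys.Smax, sys.interiorDensity lam s = 1 := by
  have hβ := (sys.decayRate_pos hlam).ne'
  have hα : 1 - sys.eff ≠ 0 := by linarith [sys.eff_lt_one]
  have h1 := sys.atomZero_mul hlam
  have h2 := sys.meanRate_mul_one_sub_eff lam
  have h3 : sys.meanRate lam / sys.decayRate lam = (1 + sys.eff) / (1 - sys.eff) := by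
    rw [div_eq_div_iff hβ hα, h2]; ring
  rw [sys.integral_interiorDensity hlam, mul_right_comm, mul_div_assoc, h3, atomMax]
  simp only [mul_zero, Real.exp_zero]
  generalize Real.exp (-(sys.decayRate lam) * sys.Smax) = κ at h1 ⊢
  field_simp
  linear_combination h1

theorem isProbabilityMeasure_stationaryLaw (hlam : 0 < lam) :
    IsProbabilityMeasure (sys.stationaryLaw lam) := by
  constructor
  have := sys.lintegral_stationaryLaw hlam (h := fun _ => 1) measurable_const
    (fun _ _ => zero_le_one)
    ((sys.continuous_interiorDensity.mul continuous_const).intervalIntegrable _ _)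
  simpa [sys.stationary_total_mass hlam] using this

theorem storedCDF_eq (hlam : 0 < lam) {t : ℝ} (h0 : 0 ≤ t) (ht : t < sys.Smax) :
    sys.storedCDF lam t = sys.atomZero lam + ∫ s in 0..t, sys.interiorDensity lam s := by
  have hβ := (sys.decayRate_pos hlam).ne'
  have hα : 1 - sys.eff ≠ 0 := by linarith [sys.eff_lt_one]
  have hN := (sys.one_sub_eff_mul_exp_pos hlam).ne'
  have h3 : sys.meanRate lam / sys.decayRate lam = (1 + sys.eff) / (1 - sys.eff) := by
    rw [div_eq_div_iff hβ hα, sys.meanRate_mul_one_sub_eff lam]; ring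
  rw [sys.integral_interiorDensity hlam, mul_right_comm, mul_div_assoc, h3, storedCDF,
    if_neg (not_lt.2 h0), if_pos ht, atomZero, exp_decayRate, exp_decayRate]
  simp only [mul_zero, Real.exp_zero]
  field_simp
  ring

theorem stationaryLaw_Iic (hlam : 0 < lam) {t : ℝ} (h0 : 0 ≤ t) (ht : t < sys.Smax) :
    sys.stationaryLaw lam (Subtype.val ⁻¹' Set.Iic t) =
      ENNReal.ofReal (sys.storedCDF lam t) := by
  have hc := sys.continuous_interiorDensity (lam := lam)
  have hfun : (fun s => sys.interiorDensity lam s * if s ≤ t then 1 else 0) =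
      fun s => if s ≤ t then sys.interiorDensity lam s else 0 := by
    ext s; split_ifs <;> simp
  have h := sys.lintegral_stationaryLaw hlam (h := fun s => if s ≤ t then 1 else 0)
    (.ite measurableSet_Iic measurable_const measurable_const)
    (fun s _ => by split_ifs <;> simp)
    (by rw [hfun]; exact intervalIntegrable_ite_le hc continuous_const h0 ht.le)
  rw [hfun, integral_ite_le hc continuous_const h0 ht.le] at h
  simp only [h0, not_le.2 ht, if_true, if_false, intervalIntegral.integral_zero, mul_one, mul_zero,
    add_zero, ← sys.storedCDF_eq hlam h0 ht] at h
  rw [← h, ← lintegral_indicator_one (measurable_subtype_coe measurableSet_Iic)]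
  refine lintegral_congr fun s => ?_
  by_cases hs : (s : ℝ) ≤ t <;> simp [hs]

/-- The two contributions are added, so the formula also covers `Smax = 0`, where the atoms merge.
-/
theorem stationaryLaw_singleton (hlam : 0 < lam) (x : ℝ) :
    sys.stationaryLaw lam (Subtype.val ⁻¹' {x}) =
      ENNReal.ofReal (sys.atomZero lam * (if 0 = x then 1 else 0) +
        sys.atomMax lam * (if sys.Smax = x then 1 else 0)) := by
  have hfun : (fun s => sys.interiorDensity lam s * if s = x then 1 else 0) =ᵐ[volume] 0 := by
    filter_upwards [measure_eq_zero_iff_ae_notMem.1 (measure_singleton (μ := volume) x)] with s hs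
    have : s ≠ x := hs
    simp [this]
  have h := sys.lintegral_stationaryLaw hlam (h := fun s => if s = x then 1 else 0)
    (.ite (measurableSet_singleton x) measurable_const measurable_const)
    (fun s _ => by split_ifs <;> simp)
    ((intervalIntegrable_const (c := (0 : ℝ))).congr_ae (ae_restrict_of_ae hfun.symm))
  rw [intervalIntegral.integral_congr_ae (g := fun _ => 0) (hfun.mono fun s hs _ => hs),
    intervalIntegral.integral_zero, add_zero] at h
  rw [← h, ← lintegral_indicator_one (measurable_subtype_coe (measurableSet_singleton x))]
  refine lintegral_congr fun s => ?_
  by_cases hs : (s : ℝ) = x <;> simp [hs]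

/-! ### Invariance of the stationary law. -/

/-- Flux balance across `t`: the mass leaving `[0, t]` and the mass entering it in one step are both
ae^{-βt}/2, so the mass of `[0, t]` is unchanged. -/
theorem integral_stepCDF (hlam : 0 < lam) {t : ℝ} (h0 : 0 ≤ t) (ht : t < sys.Smax) :
    sys.atomZero lam * sys.stepCDF lam t 0 + sys.atomMax lam * sys.stepCDF lam t sys.Smax +
      ∫ s in 0..sys.Smax, sys.interiorDensity lam s * sys.stepCDF lam t s =
    sys.atomZero lam + ∫ s in 0..t, sys.interiorDensity lam s := by
  have hγ := (sys.meanRate_pos hlam).ne'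
  have hc := sys.continuous_interiorDensity (lam := lam)
  set β := sys.decayRate lam with hβ
  set γ := sys.meanRate lam with hγ'
  set a := sys.atomZero lam with ha
  have hfun : (fun s => sys.interiorDensity lam s * sys.stepCDF lam t s) =
      fun s => if s ≤ t then
        sys.interiorDensity lam s - a * γ / 2 * Real.exp (-(γ + β) * t) * Real.exp (γ * s)
      else a * γ / 2 * Real.exp ((γ - β) * t) * Real.exp (-γ * s) := by
    ext s
    rw [stepCDF, ← meanRate_add_decayRate, ← meanRate_sub_decayRate, ← hβ, ← hγ']
    split_ifs
    · have : Real.exp (-((γ + β) * (t - s))) * Real.exp (-β * s) =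
          Real.exp (-(γ + β) * t) * Real.exp (γ * s) := by
        rw [← Real.exp_add, ← Real.exp_add]; congr 1; ring
      rw [interiorDensity, ← hβ, ← hγ', ← ha]
      linear_combination (-(a * γ / 2)) * this
    · have : Real.exp (-((γ - β) * (s - t))) * Real.exp (-β * s) =
          Real.exp ((γ - β) * t) * Real.exp (-γ * s) := by
        rw [← Real.exp_add, ← Real.exp_add]; congr 1; ring
      rw [interiorDensity, ← hβ, ← hγ', ← ha]
      linear_combination (a * γ / 2) * this
  have e1 : Real.exp (-(γ + β) * t) * Real.exp (γ * t) = Real.exp (-β * t) := by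
    rw [← Real.exp_add]; congr 1; ring
  have e2 : Real.exp ((γ - β) * t) * Real.exp (-γ * t) = Real.exp (-β * t) := by
    rw [← Real.exp_add]; congr 1; ring
  have e3 : Real.exp (-β * sys.Smax) * Real.exp (-((γ - β) * (sys.Smax - t))) =
      Real.exp ((γ - β) * t) * Real.exp (-γ * sys.Smax) := by
    rw [← Real.exp_add, ← Real.exp_add]; congr 1; ring
  have e4 : Real.exp (-((γ + β) * (t - 0))) = Real.exp (-(γ + β) * t) := by congr 1; ring
  rw [hfun, integral_ite_le (by fun_prop) (by fun_prop) h0 ht.le,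
    intervalIntegral.integral_sub (hc.intervalIntegrable _ _)
      (Continuous.intervalIntegrable (by fun_prop) _ _),
    intervalIntegral.integral_const_mul, intervalIntegral.integral_const_mul,
    integral_exp_mul_real hγ, integral_exp_mul_real (neg_ne_zero.2 hγ),
    stepCDF, if_pos h0, stepCDF, if_neg (not_le.2 ht), ← meanRate_add_decayRate,
    ← meanRate_sub_decayRate, atomMax, ← hβ, ← hγ', ← ha, e4, mul_zero, Real.exp_zero]
  -- What remains is algebra in the exponentials: `e1` and `e2` identify the opposite contributions
  -- at `t`, and `e3` cancels the integral's endpoint term at `Smax` against the atom there.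
  generalize Real.exp (-(γ + β) * t) = x₁ at *
  generalize Real.exp (γ * t) = x₂ at *
  generalize Real.exp ((γ - β) * t) = x₃ at *
  generalize Real.exp (-γ * t) = x₄ at *
  generalize Real.exp (-γ * sys.Smax) = x₅ at *
  generalize Real.exp (-β * sys.Smax) = x₆ at *
  generalize Real.exp (-((γ - β) * (sys.Smax - t))) = x₇ at *
  field_simp
  linear_combination a * e3 - a * e1 + a * e2

theorem measurable_stepCDF (t : ℝ) : Measurable (sys.stepCDF lam t) :=
  .ite measurableSet_Iic (by fun_prop) (by fun_prop)

theorem stepCDF_nonneg (hlam : 0 < lam) (t s : ℝ) : 0 ≤ sys.stepCDF lam t s := by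
  rw [stepCDF]
  split_ifs with h
  · have : Real.exp (-(lam / sys.ac * (t - s))) ≤ 1 := by
      rw [Real.exp_le_one_iff]
      exact neg_nonpos.2 (mul_nonneg (div_nonneg hlam.le sys.ac_pos.le) (sub_nonneg.2 h))
    linarith
  · positivity

theorem intervalIntegrable_interiorDensity_mul_stepCDF {t : ℝ} (h0 : 0 ≤ t) (ht : t ≤ sys.Smax) :
    IntervalIntegrable (fun s => sys.interiorDensity lam s * sys.stepCDF lam t s) volume 0
      sys.Smax := by
  have hc := sys.continuous_interiorDensity (lam := lam)
  simp only [stepCDF, mul_ite]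
  exact intervalIntegrable_ite_le (by fun_prop) (by fun_prop) h0 ht

theorem bind_stationaryLaw_Iic (hlam : 0 < lam) {t : ℝ} (h0 : 0 ≤ t) (ht : t < sys.Smax) :
    (sys.stationaryLaw lam).bind (sys.kernel lam) (Subtype.val ⁻¹' Set.Iic t) =
      ENNReal.ofReal (sys.storedCDF lam t) := by
  rw [Measure.bind_apply (measurable_subtype_coe measurableSet_Iic) (Kernel.aemeasurable _)]
  simp only [sys.kernel_Iic hlam _ h0 ht]
  rw [sys.lintegral_stationaryLaw hlam (sys.measurable_stepCDF t)
    (fun s _ => sys.stepCDF_nonneg hlam t s)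
    (sys.intervalIntegrable_interiorDensity_mul_stepCDF h0 ht.le),
    sys.integral_stepCDF hlam h0 ht, sys.storedCDF_eq hlam h0 ht]

/-- The cdf of a law on `[0, Smax]` is determined by its values on `[0, Smax)`. -/
theorem cdf_map_val_eq_storedCDF {μ : Measure sys.Level} [IsProbabilityMeasure μ]
    (h : ∀ t, 0 ≤ t → t < sys.Smax →
      μ (Subtype.val ⁻¹' Set.Iic t) = ENNReal.ofReal (sys.storedCDF lam t))
    (hnn : ∀ t, 0 ≤ t → t < sys.Smax → 0 ≤ sys.storedCDF lam t) (t : ℝ) :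
    cdf (μ.map Subtype.val) t = sys.storedCDF lam t := by
  have := Measure.isProbabilityMeasure_map (μ := μ) measurable_subtype_coe.aemeasurable
  rw [cdf_eq_real, map_measureReal_apply measurable_subtype_coe measurableSet_Iic, Measure.real]
  by_cases h0 : t < 0
  · have : (Subtype.val ⁻¹' Set.Iic t : Set sys.Level) = ∅ :=
      Set.eq_empty_of_forall_notMem fun s hs => absurd (s.2.1.trans hs) (not_le.2 h0)
    simp [this, storedCDF, h0]
  by_cases ht : t < sys.Smax
  · rw [h t (not_lt.1 h0) ht, ENNReal.toReal_ofReal (hnn t (not_lt.1 h0) ht)]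
  · have : (Subtype.val ⁻¹' Set.Iic t : Set sys.Level) = Set.univ :=
      Set.eq_univ_of_forall fun s => s.2.2.trans (not_lt.1 ht)
    simp [this, storedCDF, h0, ht]

theorem storedCDF_nonneg (hlam : 0 < lam) {t : ℝ} (h0 : 0 ≤ t) (ht : t < sys.Smax) :
    0 ≤ sys.storedCDF lam t := by
  rw [sys.storedCDF_eq hlam h0 ht]
  exact add_nonneg (sys.atomZero_pos hlam).le
    (intervalIntegral.integral_nonneg h0 fun s _ => (sys.interiorDensity_pos hlam s).le)

theorem cdf_stationaryLaw (hlam : 0 < lam) (t : ℝ) :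
    cdf ((sys.stationaryLaw lam).map Subtype.val) t = sys.storedCDF lam t := by
  have := sys.isProbabilityMeasure_stationaryLaw hlam
  exact sys.cdf_map_val_eq_storedCDF (fun _ => sys.stationaryLaw_Iic hlam)
    (fun _ => sys.storedCDF_nonneg hlam) t

theorem invariant_stationaryLaw (hlam : 0 < lam) :
    (sys.kernel lam).Invariant (sys.stationaryLaw lam) := by
  have := sys.isProbabilityMeasure_stationaryLaw hlam
  have := sys.isMarkovKernel_kernel hlam
  have h1 := Measure.isProbabilityMeasure_map (μ := sys.stationaryLaw lam)
    measurable_subtype_coe.aemeasurable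
  have h2 := Measure.isProbabilityMeasure_map
    (μ := (sys.stationaryLaw lam).bind (sys.kernel lam)) measurable_subtype_coe.aemeasurable
  -- Both laws are pushed to `ℝ`, where a probability measure is determined by its cdf.
  refine (MeasurableEmbedding.subtype_coe measurableSet_Icc).map_injective
    (Measure.eq_of_cdf _ _ ?_)
  refine StieltjesFunction.ext fun t => ?_
  rw [sys.cdf_stationaryLaw hlam]
  exact sys.cdf_map_val_eq_storedCDF (fun _ => sys.bind_stationaryLaw_Iic hlam)
    (fun _ => sys.storedCDF_nonneg hlam) t

/-! ### Fast-ramping generation in the stationary regime. -/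

/-- The mean of e^{-λα_d s} is a + ae^{-γSmax} + a(1 - e^{-γSmax}) = 2a: since λα_d = γ - β, the
density turns into aγe^{-γs}, and the atom at `Smax` restores what its integral lacks. -/
theorem integral_generation_cdf (hlam : 0 < lam) (g : ℝ) :
    sys.atomZero lam * (1 - Real.exp (-(lam * (g + sys.ad * 0))) / 2) +
      sys.atomMax lam * (1 - Real.exp (-(lam * (g + sys.ad * sys.Smax))) / 2) +
      ∫ s in 0..sys.Smax,
        sys.interiorDensity lam s * (1 - Real.exp (-(lam * (g + sys.ad * s))) / 2) =
    1 - sys.atomZero lam * Real.exp (-lam * g) := by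
  have hγ := (sys.meanRate_pos hlam).ne'
  have hc := sys.continuous_interiorDensity (lam := lam)
  have hexp (s : ℝ) : Real.exp (-(sys.decayRate lam) * s) *
      Real.exp (-(lam * (g + sys.ad * s))) =
      Real.exp (-lam * g) * Real.exp (-(sys.meanRate lam) * s) := by
    rw [← Real.exp_add, ← Real.exp_add]
    congr 1
    linear_combination s * sys.meanRate_sub_decayRate lam
  have hfun : (fun s => sys.interiorDensity lam s *
        (1 - Real.exp (-(lam * (g + sys.ad * s))) / 2)) =
      fun s => sys.interiorDensity lam s - sys.atomZero lam * sys.meanRate lam / 2 *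
        Real.exp (-lam * g) * Real.exp (-(sys.meanRate lam) * s) := by
    ext s
    rw [interiorDensity]
    linear_combination (-(sys.atomZero lam * sys.meanRate lam / 2)) * hexp s
  have e0 : Real.exp (-(lam * (g + sys.ad * 0))) = Real.exp (-lam * g) := by congr 1; ring
  rw [hfun, intervalIntegral.integral_sub (hc.intervalIntegrable _ _)
      (Continuous.intervalIntegrable (by fun_prop) _ _), intervalIntegral.integral_const_mul,
    integral_exp_mul_real (neg_ne_zero.2 hγ), e0, mul_zero, Real.exp_zero]
  have hmass := sys.stationary_total_mass hlam
  have hM := hexp sys.Smax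
  rw [atomMax] at hmass ⊢
  generalize Real.exp (-(sys.decayRate lam) * sys.Smax) = x₁ at *
  generalize Real.exp (-(lam * (g + sys.ad * sys.Smax))) = x₂ at *
  generalize Real.exp (-(sys.meanRate lam) * sys.Smax) = x₃ at *
  generalize Real.exp (-lam * g) = x₄ at *
  field_simp
  linear_combination 2 * hmass - sys.atomZero lam * hM

theorem cdf_generationLaw_stationaryLaw (hlam : 0 < lam) (g : ℝ) :
    cdf (sys.generationLaw lam (sys.stationaryLaw lam)) g = sys.generationCDF lam g := by
  have := isProbabilityMeasure_laplaceMeasure hlam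
  have := sys.isProbabilityMeasure_stationaryLaw hlam
  have := sys.isProbabilityMeasure_generationLaw hlam (sys.stationaryLaw lam)
  rw [cdf_eq_real, Measure.real]
  by_cases h0 : g < 0
  · rw [generationLaw, Measure.map_apply sys.measurable_generation measurableSet_Iic]
    have : (fun p : sys.Level × ℝ => sys.generation p.1 p.2) ⁻¹' Set.Iic g = ∅ :=
      Set.eq_empty_of_forall_notMem fun p hp =>
        absurd ((sys.generation_nonneg p.1 p.2).trans hp) (not_le.2 h0)
    simp [this, generationCDF, h0]
  have h0' := not_lt.1 h0
  by_cases hg : g < sys.Gmax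
  · have hle (s : ℝ) (hs : 0 ≤ s) : Real.exp (-(lam * (g + sys.ad * s))) ≤ 1 := by
      rw [Real.exp_le_one_iff]
      exact neg_nonpos.2 (mul_nonneg hlam.le (add_nonneg h0' (mul_nonneg sys.ad_pos.le hs)))
    have hc := sys.continuous_interiorDensity (lam := lam)
    rw [sys.generationLaw_Iic hlam _ h0' hg, sys.lintegral_stationaryLaw hlam
      (h := fun s => 1 - Real.exp (-(lam * (g + sys.ad * s))) / 2) (by fun_prop)
      (fun s hs => by linarith [hle s hs.1]) (Continuous.intervalIntegrable (by fun_prop) _ _),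
      sys.integral_generation_cdf hlam, generationCDF, if_neg h0, if_pos hg, ← atomZero]
    -- Nonnegativity holds because `atomZero` is part of a total mass of 1.
    refine ENNReal.toReal_ofReal ?_
    have h1 : Real.exp (-lam * g) ≤ 1 := by
      rw [Real.exp_le_one_iff]; nlinarith
    have h2 : sys.atomZero lam ≤ 1 := by
      have := sys.stationary_total_mass hlam
      have := sys.atomMax_pos hlam
      have := intervalIntegral.integral_nonneg (μ := volume) sys.Smax_nonneg
        fun s _ => (sys.interiorDensity_pos hlam s).le
      linarith
    have := mul_le_one₀ h2 (Real.exp_pos _).le h1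
    linarith
  · rw [generationLaw, Measure.map_apply sys.measurable_generation measurableSet_Iic]
    have : (fun p : sys.Level × ℝ => sys.generation p.1 p.2) ⁻¹' Set.Iic g = Set.univ :=
      Set.eq_univ_of_forall fun p => (sys.generation_le_Gmax p.1 p.2).trans (not_lt.1 hg)
    simp [this, generationCDF, h0, hg]

end StorageSystem

/-! ### The stationary regime. -/

theorem proposition3 (sys : StorageSystem) (lam : ℝ) (hlam : 0 < lam) :
    ∃ π : Measure sys.Level, IsProbabilityMeasure π ∧
      -- `π` is the unique stationary distribution of the stored power chain
      (sys.kernel lam).Invariant π ∧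
      (∀ ν : Measure sys.Level, IsProbabilityMeasure ν → (sys.kernel lam).Invariant ν → ν = π) ∧
      -- its cdf
      (∀ s : ℝ, cdf (π.map Subtype.val) s = sys.storedCDF lam s) ∧
      -- its atoms at the two ends
      (0 < sys.Smax →
        (π.map Subtype.val).real {0} = (1 - sys.eff) /
          (2 * (1 - sys.eff * Real.exp (-(1 / sys.ac - sys.ad) * lam * sys.Smax / 2))) ∧
        (π.map Subtype.val).real {sys.Smax} =
          (1 - sys.eff) * Real.exp (-(1 / sys.ac - sys.ad) * lam * sys.Smax / 2) /
          (2 * (1 - sys.eff * Real.exp (-(1 / sys.ac - sys.ad) * lam * sys.Smax / 2)))) ∧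
      -- the cdf of the corresponding fast-ramping generation
      IsProbabilityMeasure (sys.generationLaw lam π) ∧
      (∀ g : ℝ, cdf (sys.generationLaw lam π) g = sys.generationCDF lam g) ∧
      -- the same for the stored power sequence driven by IID Laplace prediction errors
      (∀ (Ω : Type*) [MeasurableSpace Ω] (P : Measure Ω) [IsProbabilityMeasure P]
        (Δ : ℕ → Ω → ℝ) (S : ℕ → Ω → sys.Level), sys.IsStoredPower lam P Δ S →
        ((∀ i, P.map (S i) = P.map (S 0)) ↔ P.map (S 0) = π) ∧
        (P.map (S 0) = π → ∀ (i : ℕ) (g : ℝ),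
          cdf (P.map fun ω => sys.generation (S i ω) (Δ i ω)) g = sys.generationCDF lam g)) := by
  have hπ := sys.isProbabilityMeasure_stationaryLaw hlam
  have hinv := sys.invariant_stationaryLaw hlam
  have hreal (x : ℝ) : ((sys.stationaryLaw lam).map Subtype.val).real {x} =
      sys.atomZero lam * (if 0 = x then 1 else 0) +
        sys.atomMax lam * (if sys.Smax = x then 1 else 0) := by
    rw [map_measureReal_apply measurable_subtype_coe (measurableSet_singleton x), Measure.real,
      sys.stationaryLaw_singleton hlam, ENNReal.toReal_ofReal]
    have := sys.atomZero_pos hlam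
    have := sys.atomMax_pos hlam
    positivity
  refine ⟨sys.stationaryLaw lam, hπ, hinv,
    fun ν _ hν => sys.invariant_unique hlam hν hinv, sys.cdf_stationaryLaw hlam, fun hM => ⟨?_, ?_⟩,
    sys.isProbabilityMeasure_generationLaw hlam _, sys.cdf_generationLaw_stationaryLaw hlam, ?_⟩
  · rw [hreal, if_pos rfl, if_neg hM.ne', mul_one, mul_zero, add_zero, StorageSystem.atomZero]
  · rw [hreal, if_neg hM.ne, if_pos rfl, mul_one, mul_zero, zero_add, StorageSystem.atomMax,
      StorageSystem.atomZero, sys.exp_decayRate, div_mul_eq_mul_div]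
  · intro Ω _ P _ Δ S h
    have hS (h0 : P.map (S 0) = sys.stationaryLaw lam) (i : ℕ) :
        P.map (S i) = sys.stationaryLaw lam := by
      induction i with
      | zero => exact h0
      | succ i ih => rw [h.map_succ hlam, ih, hinv.def]
    refine ⟨⟨fun hid => ?_, fun h0 i => (hS h0 i).trans h0.symm⟩, fun h0 i g => ?_⟩
    · have := Measure.isProbabilityMeasure_map (μ := P) h.measurable_init.aemeasurable
      -- Equality of the first two laws is already invariance of the law of `S 0`.
      exact sys.invariant_unique hlam ((h.map_succ hlam 0).symm.trans (hid 1)) hinv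
    · rw [h.map_generation, hS h0 i, sys.cdf_generationLaw_stationaryLaw hlam]
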